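/- Let $\mathbf{k}$ be a field and let $G$ be a finite simple graph with vertex set $V$. For $W\subseteq V$ let $G[W]$ be the induced subgraph on $W$, and let $\mathrm{Ind}(G[W])$ be its independence complex, i.e. the simplicial complex on $W$ whose faces are the independent sets of $G[W]$. For integers $i,j\ge 0$ define the bigraded Betti number of the edge ideal $I_G=(x_ux_v : uv\in E(G))\subseteq \mathbf{k}[x_v : v\in V]$ by $$\beta_{i,j}(I_G)=\sum_{W\subseteq V,\ |W|=j}\dim_{\mathbf{k}}\tilde H_{j-i-2}\bigl(\mathrm{Ind}(G[W]);\mathbf{k}\bigr),$$ where $\tilde H_*$ denotes reduced simplicial homology (with the empty set counted as the face of dimension $-1$). **Corollary.** Let $i\ge 0$ and $j$ be integers with $i+2\le j\le 2i+2$. If $G$ is triangle-free and $\beta_{i,j}(I_G)=0$, then $\chi(G)\le j-1$. -/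

import Mathlib

open Finset

set_option maxSynthPendingDepth 3

noncomputable section

/-- The independence complex `Ind(G)` of a graph: its faces are the (nonempty) independent sets of
vertices of `G`. The empty face is left out by Mathlib's convention for simplicial complexes; it is
put back in `ReducedHomology.chains`. -/
def independenceComplex {V : Type*} (G : SimpleGraph V) : AbstractSimplicialComplex V where
  faces := {s | s.Nonempty ∧ G.IsIndepSet (s : Set V)}
  isRelLowerSet_faces := fun _ hs =>
    ⟨hs.1, fun _ hts ht => ⟨ht, hs.2.mono (Finset.coe_subset.mpr hts)⟩⟩
  singleton_mem := fun v => ⟨Finset.singleton_nonempty v, by simp [SimpleGraph.IsIndepSet]⟩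

/-! Reduced simplicial homology of an abstract simplicial complex with coefficients in a field `k`.
The vertices are linearly ordered and the order is used only to orient the simplices (to choose the
signs of the boundary map). -/

namespace ReducedHomology

variable {V : Type*} (k : Type*) [Field k]

/-- The simplicial boundary map on formal `k`-linear combinations of finite vertex sets:
`∂ {v₀ < v₁ < ⋯ < v_d} = ∑ₐ (-1) ^ a • {v₀, …, v_d} ∖ {v_a}`; here `a`, the position of `v_a`,
is the number of elements of the simplex that are smaller than `v_a`. In particular `∂ {v} = ∅`
(the augmentation) and `∂ ∅ = 0`. -/
def boundary [LinearOrder V] : (Finset V →₀ k) →ₗ[k] (Finset V →₀ k) :=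
  Finsupp.linearCombination k fun s : Finset V =>
    ∑ v ∈ s, Finsupp.single (s.erase v) ((-1 : k) ^ #{w ∈ s | w < v})

/-- The reduced `d`-chains of `K`: linear combinations of the faces of `K` that have exactly
`d + 1` vertices, where the empty set counts as a face of dimension `-1`. -/
def chains (K : AbstractSimplicialComplex V) (d : ℤ) : Submodule k (Finset V →₀ k) :=
  Finsupp.supported k k {s | (s = ∅ ∨ s ∈ K) ∧ (#s : ℤ) = d + 1}

/-- The reduced `d`-cycles of `K`. -/
def cycles [LinearOrder V] (K : AbstractSimplicialComplex V) (d : ℤ) :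
    Submodule k (Finset V →₀ k) :=
  chains k K d ⊓ LinearMap.ker (boundary k)

/-- The reduced `d`-boundaries of `K`: the images of the `(d + 1)`-chains. -/
def boundaries [LinearOrder V] (K : AbstractSimplicialComplex V) (d : ℤ) :
    Submodule k (Finset V →₀ k) :=
  (chains k K (d + 1)).map (boundary k)

theorem boundary_single [LinearOrder V] (s : Finset V) (c : k) :
    boundary k (Finsupp.single s c) =
      c • ∑ v ∈ s, Finsupp.single (s.erase v) ((-1 : k) ^ #{w ∈ s | w < v}) := by
  simp [boundary]

theorem boundary_boundary [LinearOrder V] (x : Finset V →₀ k) :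
    boundary k (boundary k x) = 0 := by
  induction x using Finsupp.induction_linear with
  | zero => simp
  | add f g hf hg => rw [map_add, map_add, hf, hg, add_zero]
  | single s c =>
    rw [boundary_single, map_smul, map_sum]
    simp only [boundary_single, Finset.smul_sum]
    rw [Finset.sum_sigma']
    have key : ∀ u v : V, u ∈ s → u < v →
        #{w ∈ s.erase u | w < v} + 1 = #{w ∈ s | w < v} ∧
        #{w ∈ s.erase v | w < u} = #{w ∈ s | w < u} := by
      intro u v hu huv
      constructor
      · rw [Finset.filter_erase, Finset.card_erase_add_one (by simp [hu, huv])]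
      · rw [Finset.filter_erase, Finset.erase_eq_of_notMem (by simp [huv.le])]
    refine Finset.sum_involution (fun p _ => ⟨p.2, p.1⟩) ?_ ?_ ?_ ?_
    · rintro ⟨v, u⟩ h
      simp only [Finset.mem_sigma, Finset.mem_erase] at h
      obtain ⟨hv, huv, hu⟩ := h
      simp only [Finsupp.smul_single, smul_eq_mul]
      rw [Finset.erase_right_comm (a := v), ← Finsupp.single_add]
      refine (congrArg _ ?_).trans (Finsupp.single_zero _)
      rcases lt_or_gt_of_ne huv with h | h
      · obtain ⟨h1, h2⟩ := key u v hu h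
        rw [← h1, h2]; ring
      · obtain ⟨h1, h2⟩ := key v u hv h
        rw [← h1, h2]; ring
    · rintro ⟨v, u⟩ h _ heq
      simp only [Finset.mem_sigma, Finset.mem_erase] at h
      simp only [Sigma.mk.injEq] at heq
      exact h.2.1 heq.1
    · rintro ⟨v, u⟩ h
      simp only [Finset.mem_sigma, Finset.mem_erase] at h ⊢
      exact ⟨h.2.2, h.2.1.symm, h.1⟩
    · rintro ⟨v, u⟩ _
      rfl

theorem boundary_mem_chains [LinearOrder V] (K : AbstractSimplicialComplex V) (d : ℤ)
    {x : Finset V →₀ k} (hx : x ∈ chains k K (d + 1)) : boundary k x ∈ chains k K d := by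
  rw [boundary, Finsupp.linearCombination_apply]
  refine Submodule.sum_mem _ fun s hs => Submodule.smul_mem _ _ (Submodule.sum_mem _ fun v hv => ?_)
  obtain ⟨hK, hcard⟩ := (Finsupp.mem_supported _ _).1 hx hs
  refine Finsupp.single_mem_supported k _ ⟨?_, ?_⟩
  · rcases (s.erase v).eq_empty_or_nonempty with h | h
    · exact Or.inl h
    · rcases hK with rfl | hK
      · simp at hv
      · exact Or.inr ((K.isRelLowerSet_faces hK).2 (Finset.erase_subset v s) h)
  · have := Finset.card_erase_add_one hv
    push_cast [← this] at hcard
    linarith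

/-- Boundaries are cycles. -/
theorem boundaries_le_cycles [LinearOrder V] (K : AbstractSimplicialComplex V) (d : ℤ) :
    boundaries k K d ≤ cycles k K d := by
  rintro _ ⟨x, hx, rfl⟩
  exact ⟨boundary_mem_chains k K d hx, boundary_boundary k x⟩

end ReducedHomology

/-- The reduced simplicial homology `H̃_d(K; k)`: reduced `d`-cycles modulo `d`-boundaries. -/
abbrev ReducedHomology {V : Type*} [LinearOrder V] (k : Type*) [Field k]
    (K : AbstractSimplicialComplex V) (d : ℤ) : Type _ :=
  ↥(ReducedHomology.cycles k K d) ⧸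
    (ReducedHomology.boundaries k K d).submoduleOf (ReducedHomology.cycles k K d)

/-- The bigraded Betti number
`β_{i,j}(I_G) = ∑_{W ⊆ V, |W| = j} dim_k H̃_{j-i-2}(Ind(G[W]); k)`
of the edge ideal `I_G` over the field `k`. -/
def edgeIdealBetti {V : Type*} [Fintype V] [LinearOrder V] (k : Type*) [Field k]
    (G : SimpleGraph V) (i j : ℕ) : ℕ :=
  ∑ W ∈ (Finset.univ : Finset V).powersetCard j,
    Module.finrank k
      (ReducedHomology k (independenceComplex (G.induce (W : Set V))) ((j : ℤ) - (i : ℤ) - 2))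

end

open SimpleGraph

/-! Contrapositive. If `G` is triangle-free and not `(j - 1)`-colourable, put `n = j - i - 2`. Some
`j` vertices `W` then induce `n` disjoint edges plus a star, with no edges between components. The
independence complex of each component is homotopically a 0-sphere and that of the union is their
join, so it has homology in degree `n` and `β_{i,j} ≠ 0`. To find `W` (`exists_hasDominatingCycle`),
split off an edge `uv`: by triangle-freeness the neighbours of `u` and of `v` use only two colours,
so the rest still needs many. Greedy colouring finally gives a vertex of large degree. The join is
made by hand (`HasDominatingCycle.extend`): a cycle `z` becomes the difference of its cones over `u`
and `v`. A nonzero coefficient on a maximal face keeps it from bounding. -/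

noncomputable section

/-! ### Cones and boundaries of chains -/

namespace ReducedHomology

variable {V : Type*} (k : Type*) [Field k] [LinearOrder V]

/-- The signed cone with apex `u`, sending a simplex `s` to `± (s ∪ {u})`. -/
def cone (u : V) : (Finset V →₀ k) →ₗ[k] (Finset V →₀ k) :=
  Finsupp.linearCombination k fun s : Finset V =>
    Finsupp.single (insert u s) ((-1 : k) ^ #{w ∈ s | w < u})

theorem cone_single (u : V) (s : Finset V) (c : k) :
    cone k u (Finsupp.single s c) =
      c • Finsupp.single (insert u s) ((-1 : k) ^ #{w ∈ s | w < u}) := by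
  simp [cone]

/-- Exactly one exponent changes, by one: if `u < v`, inserting `u` raises the count below `v`; if
`v < u`, erasing `v` lowers the count below `u`. -/
theorem neg_one_pow_insert_mul {u v : V} {s : Finset V} (hu : u ∉ s) (hv : v ∈ s) :
    (-1 : k) ^ #{w ∈ s | w < u} * (-1) ^ #{w ∈ insert u s | w < v} =
      -((-1) ^ #{w ∈ s | w < v} * (-1) ^ #{w ∈ s.erase v | w < u}) := by
  have huv : u ≠ v := fun h => hu (h ▸ hv)
  rw [Finset.filter_insert, Finset.filter_erase]
  rcases lt_or_gt_of_ne huv with h | h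
  · rw [if_pos h, Finset.card_insert_of_notMem (by simp [hu]),
      Finset.erase_eq_of_notMem (by simp [h.le])]
    ring
  · rw [if_neg h.le.not_gt, ← Finset.card_erase_add_one (s := {w ∈ s | w < u}) (a := v)
      (by simp [hv, h])]
    ring

theorem boundary_cone_single {u : V} {s : Finset V} (hu : u ∉ s) (c : k) :
    boundary k (cone k u (Finsupp.single s c)) =
      Finsupp.single s c - cone k u (boundary k (Finsupp.single s c)) := by
  rw [cone_single, map_smul, boundary_single, boundary_single, map_smul, map_sum,
    Finset.sum_insert hu, Finset.erase_insert hu]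
  simp only [cone_single, Finset.smul_sum, smul_add, Finsupp.smul_single, smul_eq_mul]
  have hf : #{w ∈ insert u s | w < u} = #{w ∈ s | w < u} := by
    rw [Finset.filter_insert, if_neg (lt_irrefl u)]
  have hsq : (-1 : k) ^ #{w ∈ s | w < u} * (-1) ^ #{w ∈ s | w < u} = 1 := by
    rw [← mul_pow]; simp
  rw [hf, hsq, mul_one, sub_eq_add_neg, ← Finset.sum_neg_distrib]
  congr 1
  refine Finset.sum_congr rfl fun v hv => ?_
  have huv : v ≠ u := fun h => hu (h ▸ hv)
  rw [Finset.erase_insert_of_ne huv.symm, neg_one_pow_insert_mul k hu hv, ← Finsupp.single_neg,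
    mul_neg]

/-- The cone is a contracting homotopy on chains avoiding its apex; for a cycle `x` the last term
vanishes. -/
theorem boundary_cone {u : V} {x : Finset V →₀ k} (hx : ∀ s ∈ x.support, u ∉ s) :
    boundary k (cone k u x) = x - cone k u (boundary k x) := by
  conv_lhs => rw [← x.sum_single]
  conv_rhs => rw [← x.sum_single]
  simp only [Finsupp.sum, map_sum, ← Finset.sum_sub_distrib]
  exact Finset.sum_congr rfl fun s hs => boundary_cone_single k (hx s hs) _

theorem exists_of_mem_support_cone {u : V} {x : Finset V →₀ k} {t : Finset V}
    (ht : t ∈ (cone k u x).support) : ∃ s ∈ x.support, t = insert u s := by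
  by_contra! h
  rw [Finsupp.mem_support_iff, cone, Finsupp.linearCombination_apply, Finsupp.sum,
    Finsupp.finsetSum_apply] at ht
  refine ht (Finset.sum_eq_zero fun s hs => ?_)
  rw [Finsupp.smul_single, Finsupp.single_eq_of_ne (h s hs)]

theorem cone_apply_insert {u : V} {x : Finset V →₀ k} (hx : ∀ s ∈ x.support, u ∉ s)
    {S : Finset V} (hS : u ∉ S) :
    cone k u x (insert u S) = x S * (-1) ^ #{w ∈ S | w < u} := by
  rw [cone, Finsupp.linearCombination_apply, Finsupp.sum, Finsupp.finsetSum_apply,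
    Finset.sum_eq_single S]
  · simp
  · intro s hs hne
    rw [Finsupp.smul_single, Finsupp.single_eq_of_ne]
    intro h
    apply hne
    rw [← Finset.erase_insert (hx s hs), ← h, Finset.erase_insert hS]
  · intro h
    simp [Finsupp.notMem_support_iff.1 h]

theorem boundary_mapDomain {U : Type*} [LinearOrder U] (f : U ↪o V) (x : Finset U →₀ k) :
    boundary k (x.mapDomain (Finset.map f.toEmbedding)) =
      (boundary k x).mapDomain (Finset.map f.toEmbedding) := by
  induction x using Finsupp.induction_linear with
  | zero => simp
  | add x y hx hy => simp only [Finsupp.mapDomain_add, map_add, hx, hy]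
  | single s c =>
    rw [Finsupp.mapDomain_single, boundary_single, boundary_single, Finsupp.mapDomain_smul,
      Finsupp.mapDomain_finsetSum, Finset.sum_map]
    congr 1
    refine Finset.sum_congr rfl fun v _ => ?_
    rw [Finsupp.mapDomain_single, Finset.map_erase, Finset.filter_map, Finset.card_map]
    congr 4
    ext w
    simp

/-- The coefficient of a maximal face vanishes in every boundary. -/
theorem apply_eq_zero_of_mem_boundaries {K : AbstractSimplicialComplex V} {d : ℤ}
    {x : Finset V →₀ k} (hx : x ∈ boundaries k K d) {S : Finset V}
    (hS : ∀ v ∉ S, insert v S ∉ K) : x S = 0 := by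
  obtain ⟨y, hy, rfl⟩ := hx
  rw [boundary, Finsupp.linearCombination_apply, Finsupp.sum, Finsupp.finsetSum_apply]
  refine Finset.sum_eq_zero fun s hs => ?_
  rw [Finsupp.smul_apply, Finsupp.finsetSum_apply, Finset.sum_eq_zero, smul_zero]
  intro v hv
  refine Finsupp.single_eq_of_ne ?_
  rintro rfl
  have hsK := ((Finsupp.mem_supported _ _).1 hy hs).1
  have h := hS v (Finset.notMem_erase v s)
  rw [Finset.insert_erase hv] at h
  rcases hsK with rfl | hsK
  · simp at hv
  · exact h hsK

end ReducedHomology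

open ReducedHomology

/-! ### Cycles that are nonzero on a dominating independent set -/

section Graph

variable {V : Type*} (k : Type*) [Field k] [LinearOrder V] (G : SimpleGraph V)

/-- `W` carries a cycle of `Ind(G)`, made of independent sets with `n` vertices, that has a nonzero
coefficient at some set dominating `W`. -/
def HasDominatingCycle (W : Finset V) (n : ℕ) : Prop :=
  ∃ (S : Finset V) (z : Finset V →₀ k), z S ≠ 0 ∧ boundary k z = 0 ∧
    (∀ s ∈ z.support, s ⊆ W ∧ G.IsIndepSet (s : Set V) ∧ #s = n) ∧
    ∀ w ∈ W, w ∉ S → ∃ x ∈ S, G.Adj x w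

theorem hasDominatingCycle_empty : HasDominatingCycle k G ∅ 0 := by
  refine ⟨∅, Finsupp.single ∅ 1, by simp, by simp [boundary_single], fun s hs => ?_, by simp⟩
  obtain rfl : s = ∅ := by
    simpa using Finsupp.support_single_subset hs
  simp [SimpleGraph.IsIndepSet]

variable {k G}

theorem isIndepSet_insert_finset {u : V} {s : Finset V} (hs : G.IsIndepSet (s : Set V))
    (hu : ∀ w ∈ s, ¬ G.Adj u w) : G.IsIndepSet ((insert u s : Finset V) : Set V) := by
  rw [Finset.coe_insert]
  intro x hx y hy hxy
  rcases hx with rfl | hx <;> rcases hy with rfl | hy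
  · exact absurd rfl hxy
  · exact hu y hy
  · exact fun h => hu x hx h.symm
  · exact hs hx hy hxy

/-- Suspension with poles `u` and `v`. Since `hdom` lets `W'` contain any further neighbours of `u`,
this serves both for adding an edge and for building the star. -/
theorem HasDominatingCycle.extend {W W' : Finset V} {n : ℕ} (h : HasDominatingCycle k G W n)
    {u v : V} (huv : G.Adj u v) (hu : ∀ w ∈ W, ¬ G.Adj u w) (hv : ∀ w ∈ W, ¬ G.Adj v w)
    (hWW' : W ⊆ W') (huW' : u ∈ W') (hvW' : v ∈ W')
    (hdom : ∀ w ∈ W', w ∈ W ∨ w = u ∨ G.Adj u w) : HasDominatingCycle k G W' (n + 1) := by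
  obtain ⟨S, z, hzS, hz, hsupp, hS⟩ := h
  have huW : u ∉ W := fun h => hv u h huv.symm
  have hvW : v ∉ W := fun h => hu v h huv
  have hSW : S ⊆ W := (hsupp S (Finsupp.mem_support_iff.2 hzS)).1
  have hzu : ∀ s ∈ z.support, u ∉ s := fun s hs hus => huW ((hsupp s hs).1 hus)
  have hzv : ∀ s ∈ z.support, v ∉ s := fun s hs hvs => hvW ((hsupp s hs).1 hvs)
  have key : ∀ x : V, x ∈ W' → x ∉ W → (∀ w ∈ W, ¬ G.Adj x w) →
      ∀ t ∈ (cone k x z).support, t ⊆ W' ∧ G.IsIndepSet (t : Set V) ∧ #t = n + 1 := by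
    intro x hxW' hxW hx t ht
    obtain ⟨s, hs, rfl⟩ := exists_of_mem_support_cone k ht
    obtain ⟨h1, h2, h3⟩ := hsupp s hs
    refine ⟨Finset.insert_subset hxW' (h1.trans hWW'),
      isIndepSet_insert_finset h2 fun w hw => hx w (h1 hw), ?_⟩
    rw [Finset.card_insert_of_notMem fun h => hxW (h1 h), h3]
  refine ⟨insert u S, cone k u z - cone k v z, ?_, ?_, ?_, ?_⟩
  -- Every simplex of the cone over `v` contains `v`, so it cannot cancel the coefficient at `insert
  -- u S`.
  · have h0 : cone k v z (insert u S) = 0 := by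
      by_contra hne
      obtain ⟨s, -, hs⟩ := exists_of_mem_support_cone k (Finsupp.mem_support_iff.2 hne)
      have hvm : v ∈ insert u S := hs ▸ Finset.mem_insert_self v s
      rcases Finset.mem_insert.1 hvm with rfl | hvS
      · exact G.loopless.irrefl _ huv
      · exact hvW (hSW hvS)
    rw [Finsupp.sub_apply, h0, sub_zero, cone_apply_insert k hzu fun h => huW (hSW h)]
    exact mul_ne_zero hzS (pow_ne_zero _ (neg_ne_zero.2 one_ne_zero))
  · rw [map_sub, boundary_cone k hzu, boundary_cone k hzv, hz, map_zero, map_zero, sub_self]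
  · intro t ht
    rcases Finset.mem_union.1 (Finsupp.support_sub ht) with ht | ht
    · exact key u huW' huW hu t ht
    · exact key v hvW' hvW hv t ht
  · intro w hw hwS
    rw [Finset.mem_insert, not_or] at hwS
    rcases hdom w hw with hwW | rfl | hadj
    · obtain ⟨x, hx, hxw⟩ := hS w hwW hwS.2
      exact ⟨x, Finset.mem_insert_of_mem hx, hxw⟩
    · exact absurd rfl hwS.1
    · exact ⟨u, Finset.mem_insert_self u S, hadj⟩

theorem HasDominatingCycle.finrank_ne_zero {W : Finset V} {n : ℕ}
    (h : HasDominatingCycle k G W n) {d : ℤ} (hd : (n : ℤ) = d + 1) :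
    Module.finrank k
      (ReducedHomology k (independenceComplex (G.induce (W : Set V))) d) ≠ 0 := by
  obtain ⟨S, z, hzS, hz, hsupp, hS⟩ := h
  -- The signs of the boundary depend only on the vertex order, so `z` can be pulled back to the
  -- subtype.
  set f : (W : Set V) ↪o V := OrderEmbedding.subtype (· ∈ (W : Set V))
  set F : Finset (W : Set V) → Finset V := Finset.map f.toEmbedding
  have hF : Function.Injective F := Finset.map_injective _
  have hlift : ∀ s ⊆ W, ∃ t, F t = s := fun s hs =>
    ⟨s.subtype (· ∈ (W : Set V)), Finset.subtype_map_of_mem fun x hx => hs hx⟩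
  set y : Finset (W : Set V) →₀ k := z.comapDomain F hF.injOn
  have hyz : y.mapDomain F = z := Finsupp.mapDomain_comapDomain F hF z fun s hs =>
    hlift s (hsupp s hs).1
  have hy : boundary k y = 0 := by
    refine Finsupp.mapDomain_injective hF ?_
    rw [← boundary_mapDomain, hyz, hz, Finsupp.mapDomain_zero]
  obtain ⟨T, rfl⟩ := hlift S (hsupp S (Finsupp.mem_support_iff.2 hzS)).1
  have hcyc : y ∈ cycles k (independenceComplex (G.induce (W : Set V))) d := by
    refine ⟨(Finsupp.mem_supported _ _).2 fun s hs => ?_, hy⟩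
    have hs' : F s ∈ z.support := by
      rw [Finset.mem_coe, Finsupp.mem_support_iff] at hs
      exact Finsupp.mem_support_iff.2 hs
    obtain ⟨-, h2, h3⟩ := hsupp _ hs'
    refine ⟨?_, by rw [← hd, ← h3, Finset.card_map]⟩
    rcases s.eq_empty_or_nonempty with h | h
    · exact Or.inl h
    · refine Or.inr ⟨h, fun a ha b hb hab => ?_⟩
      exact h2 (Finset.mem_coe.2 (Finset.mem_map_of_mem _ ha))
        (Finset.mem_coe.2 (Finset.mem_map_of_mem _ hb)) fun e => hab (Subtype.ext e)
  -- A dominating independent set is a maximal face.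
  have hmax : ∀ v ∉ T, insert v T ∉ independenceComplex (G.induce (W : Set V)) := by
    intro v hv hK
    obtain ⟨x, hx, hadj⟩ := hS v v.2 fun h => hv (by
      obtain ⟨a, ha, hav⟩ := Finset.mem_map.1 h
      exact (Subtype.ext hav : a = v) ▸ ha)
    obtain ⟨a, ha, rfl⟩ := Finset.mem_map.1 hx
    refine hK.2 (Finset.mem_coe.2 (Finset.mem_insert_of_mem ha))
      (Finset.mem_coe.2 (Finset.mem_insert_self v T)) ?_ hadj
    rintro rfl
    exact hv ha
  rw [← Nat.pos_iff_ne_zero]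
  have : Nontrivial (ReducedHomology k (independenceComplex (G.induce (W : Set V))) d) := by
    refine Submodule.Quotient.nontrivial_iff.2 fun htop => hzS ?_
    have hmem : (⟨y, hcyc⟩ : cycles k (independenceComplex (G.induce (W : Set V))) d) ∈
        (boundaries k (independenceComplex (G.induce (W : Set V))) d).submoduleOf _ :=
      htop ▸ Submodule.mem_top
    exact apply_eq_zero_of_mem_boundaries k (Submodule.mem_comap.1 hmem) hmax
  exact Module.finrank_pos

/-! ### Colouring lemmas -/

/-- A colouring of the vertices in `s` with the colours `0, …, c - 1`. -/
def ColorableOn (G : SimpleGraph V) (s : Finset V) (c : ℕ) : Prop :=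
  ∃ C : V → ℕ, (∀ x ∈ s, C x < c) ∧ ∀ x ∈ s, ∀ y ∈ s, G.Adj x y → C x ≠ C y

open Classical in
-- Greedy: the neighbours of each new vertex leave one of the `c` colours free.
theorem colorableOn_of_degree_lt {c : ℕ} (s : Finset V)
    (h : ∀ u ∈ s, #{w ∈ s | G.Adj u w} < c) : ColorableOn G s c := by
  induction s using Finset.induction_on with
  | empty => exact ⟨fun _ => 0, by simp, by simp⟩
  | insert a s ha ih =>
    obtain ⟨C, hC, hproper⟩ := ih fun u hu =>
      (Finset.card_le_card (Finset.filter_subset_filter _ (Finset.subset_insert a s))).trans_lt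
        (h u (Finset.mem_insert_of_mem hu))
    obtain ⟨m, hm, hmC⟩ : ∃ m ∈ Finset.range c, m ∉ ({w ∈ s | G.Adj a w}).image C := by
      refine Finset.exists_mem_notMem_of_card_lt_card ?_
      rw [Finset.card_range]
      exact Finset.card_image_le.trans_lt ((Finset.card_le_card
        (Finset.filter_subset_filter _ (Finset.subset_insert a s))).trans_lt
          (h a (Finset.mem_insert_self a s)))
    have hne : ∀ y ∈ s, G.Adj a y → C y ≠ m := fun y hy hay e =>
      hmC (Finset.mem_image.2 ⟨y, Finset.mem_filter.2 ⟨hy, hay⟩, e⟩)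
    have hsa : ∀ y ∈ s, y ≠ a := fun y hy e => ha (e ▸ hy)
    refine ⟨Function.update C a m, ?_, ?_⟩
    · intro x hx
      rcases Finset.mem_insert.1 hx with rfl | hx
      · simpa using hm
      · rw [Function.update_of_ne (hsa x hx)]
        exact hC x hx
    · intro x hx y hy hxy
      rcases Finset.mem_insert.1 hx with rfl | hxs <;> rcases Finset.mem_insert.1 hy with rfl | hys
      · exact absurd hxy (G.loopless.irrefl _)
      · rw [Function.update_self, Function.update_of_ne (hsa y hys)]
        exact (hne y hys hxy).symm
      · rw [Function.update_self, Function.update_of_ne (hsa x hxs)]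
        exact hne x hxs hxy.symm
      · rw [Function.update_of_ne (hsa x hxs), Function.update_of_ne (hsa y hys)]
        exact hproper x hxs y hys hxy

theorem not_adj_of_common_neighbor (hG : G.CliqueFree 3) {a b c : V} (hab : G.Adj a b)
    (hac : G.Adj a c) : ¬ G.Adj b c := fun hbc =>
  hG {a, b, c} (SimpleGraph.is3Clique_triple_iff.2 ⟨hab, hac, hbc⟩)

open Classical in
-- Neighbourhoods are independent in a triangle-free graph, so one new colour suffices for that of
-- `u` and another for the rest of that of `v`.
theorem colorableOn_add_two (hG : G.CliqueFree 3) {s : Finset V} {c : ℕ} (u v : V)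
    (h : ColorableOn G {w ∈ s | ¬ G.Adj u w ∧ ¬ G.Adj v w} c) : ColorableOn G s (c + 2) := by
  obtain ⟨C, hC, hproper⟩ := h
  refine ⟨fun x => if G.Adj u x then c else if G.Adj v x then c + 1 else C x, ?_, ?_⟩
  · intro x hx
    dsimp only
    split_ifs with h1 h2
    · omega
    · omega
    · have := hC x (Finset.mem_filter.2 ⟨hx, h1, h2⟩)
      omega
  · intro x hx y hy hxy
    have hx' := fun h => hC x (Finset.mem_filter.2 ⟨hx, h⟩)
    have hy' := fun h => hC y (Finset.mem_filter.2 ⟨hy, h⟩)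
    dsimp only
    split_ifs with h1 h2 h3 h4 h5 h6 h7 h8
    · exact absurd hxy (not_adj_of_common_neighbor hG h1 h2)
    · omega
    · have := hy' ⟨h2, h3⟩
      omega
    · omega
    · exact absurd hxy (not_adj_of_common_neighbor hG h4 h6)
    · have := hy' ⟨h5, h6⟩
      omega
    · have := hx' ⟨h1, h4⟩
      omega
    · have := hx' ⟨h1, h4⟩
      omega
    · exact hproper x (Finset.mem_filter.2 ⟨hx, h1, h4⟩) y (Finset.mem_filter.2 ⟨hy, h7, h8⟩) hxy

variable (k)

open Classical in
/-- A triangle-free graph that cannot be coloured with `j - 1` colours contains an induced disjoint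
union of `n - 1` edges and a star, with `j` vertices in total. -/
theorem exists_hasDominatingCycle (hG : G.CliqueFree 3) (n : ℕ) :
    ∀ (s : Finset V) (j : ℕ), 2 * (n + 1) ≤ j → ¬ ColorableOn G s (j - 1) →
      ∃ W ⊆ s, #W = j ∧ HasDominatingCycle k G W (n + 1) := by
  induction n with
  | zero =>
    intro s j hj hs
    obtain ⟨u, hu, hdeg⟩ : ∃ u ∈ s, j - 1 ≤ #{w ∈ s | G.Adj u w} := by
      by_contra! h
      exact hs (colorableOn_of_degree_lt s h)
    obtain ⟨L, hL, hLcard⟩ := Finset.exists_subset_card_eq hdeg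
    have hLs : ∀ w ∈ L, w ∈ s ∧ G.Adj u w := fun w hw => Finset.mem_filter.1 (hL hw)
    obtain ⟨v, hv⟩ : L.Nonempty := Finset.card_pos.1 (by omega)
    refine ⟨insert u L, Finset.insert_subset hu fun w hw => (hLs w hw).1, ?_, ?_⟩
    · rw [Finset.card_insert_of_notMem fun h => G.loopless.irrefl _ (hLs u h).2]
      omega
    · refine (hasDominatingCycle_empty k G).extend (hLs v hv).2 (by simp) (by simp)
        (Finset.empty_subset _) (Finset.mem_insert_self u L) (Finset.mem_insert_of_mem hv) ?_
      intro w hw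
      rcases Finset.mem_insert.1 hw with h | h
      · exact Or.inr (Or.inl h)
      · exact Or.inr (Or.inr (hLs w h).2)
  | succ n ih =>
    intro s j hj hs
    obtain ⟨u, hu, v, hv, huv⟩ : ∃ u ∈ s, ∃ v ∈ s, G.Adj u v := by
      by_contra! h
      exact hs ⟨fun _ => 0, fun _ _ => (by omega : 0 < j - 1), fun x hx y hy hxy => absurd hxy (h x hx y hy)⟩
    -- Two vertices and two colours are spent on the edge. The filter also discards `u` and `v`,
    -- being adjacent to each other.
    obtain ⟨W, hWs, hW, hcyc⟩ := ih {w ∈ s | ¬ G.Adj u w ∧ ¬ G.Adj v w} (j - 2) (by omega)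
      fun h => hs (by
        have := colorableOn_add_two hG u v h
        rwa [show j - 2 - 1 + 2 = j - 1 by omega] at this)
    have hW' : ∀ w ∈ W, w ∈ s ∧ ¬ G.Adj u w ∧ ¬ G.Adj v w := fun w hw =>
      Finset.mem_filter.1 (hWs hw)
    have hvW : v ∉ W := fun h => (hW' v h).2.1 huv
    have huW : u ∉ insert v W := by
      rw [Finset.mem_insert, not_or]
      exact ⟨huv.ne, fun h => (hW' u h).2.2 huv.symm⟩
    refine ⟨insert u (insert v W), Finset.insert_subset hu (Finset.insert_subset hv fun w hw =>
      (hW' w hw).1), ?_, ?_⟩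
    · rw [Finset.card_insert_of_notMem huW, Finset.card_insert_of_notMem hvW]
      omega
    · refine hcyc.extend huv (fun w hw => (hW' w hw).2.1) (fun w hw => (hW' w hw).2.2)
        ((Finset.subset_insert v W).trans (Finset.subset_insert u _)) (by simp) (by simp) ?_
      intro w hw
      rcases Finset.mem_insert.1 hw with h | hw
      · exact Or.inr (Or.inl h)
      · rcases Finset.mem_insert.1 hw with rfl | hw
        · exact Or.inr (Or.inr huv)
        · exact Or.inl hw

end Graph

end

theorem mainTheorem4 {V : Type*} [Fintype V] [LinearOrder V] (k : Type*) [Field k]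
    (G : SimpleGraph V) (i j : ℕ) (hij : i + 2 ≤ j) (hji : j ≤ 2 * i + 2)
    (hG : G.CliqueFree 3) (hβ : edgeIdealBetti k G i j = 0) :
    G.chromaticNumber ≤ ((j - 1 : ℕ) : ℕ∞) := by
  rw [SimpleGraph.chromaticNumber_le_iff_colorable]
  by_contra hcol
  -- The bound `2 * (n + 1) ≤ j` for `n = j - i - 2` is exactly `j ≤ 2 * i + 2`; `hij` makes the
  -- truncated subtraction agree with the integer degree.
  obtain ⟨W, -, hW, hcyc⟩ := exists_hasDominatingCycle k hG (j - i - 2) Finset.univ j (by omega)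
    fun ⟨C, hC, hproper⟩ => hcol ⟨SimpleGraph.Coloring.mk
      (fun x => (⟨C x, hC x (Finset.mem_univ x)⟩ : Fin (j - 1))) fun {x y} hxy e =>
        hproper x (Finset.mem_univ x) y (Finset.mem_univ y) hxy (Fin.mk.inj_iff.1 e)⟩
  exact hcyc.finrank_ne_zero (by omega) (Finset.sum_eq_zero_iff.1 hβ W
    (Finset.mem_powersetCard.2 ⟨Finset.subset_univ W, hW⟩))
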